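/- Let $\Omega\subset\mathbb R^m$ be a simply connected open set with a smooth Riemannian metric $g$, and let $\nu:\Omega\to S^m\subset\mathbb R^{m+1}$ be a smooth map such that $A=d\nu:T\Omega\to\nu^\perp$ is invertible at every point, where $\nu^\perp$ is the vector bundle with fibres $\nu(x)^\perp\subset\mathbb R^{m+1}$. Let $A^*:\nu^\perp\to T\Omega$ be the adjoint of $A$ with respect to $g$ and the Euclidean inner product, and let $k(v,w)=\langle Av,Aw\rangle=g(A^*Av,w)$ be the third fundamental form; bilinear forms on $T\Omega$ are identified with endomorphisms of $T\Omega$ by means of $g$. A *solution* for $(g,\nu)$ is a smooth immersion $u:\Omega\to\mathbb R^{m+1}$ with first fundamental form $g$ and Gauß map $\nu$, i.e. $\langle du\,v,du\,w\rangle=g(v,w)$ and $\langle du\,v,\nu\rangle=0$ for all tangent vectors $v,w$; its second fundamental form is $h(v,w)=\langle D^2u(v,w),\nu\rangle$. Call a smooth symmetric bilinear form $h$ on $\Omega$ *compatible* with $(g,\nu)$ if $h^2=k$ and the bundle homomorphism $U_h=-(A^*)^{-1}h:T\Omega\to\nu^\perp$ is isometric and parallel with respect to the Levi-Civita connection of $g$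 on $T\Omega$ and the projection connection on $\nu^\perp$ (the derivative in $\mathbb R^{m+1}$ followed by the orthogonal projection onto $\nu^\perp$). Then: 1. A solution for $(g,\nu)$ exists if and only if there is a compatible $h$. 2. If $h$ is compatible, then there is a map $u:\Omega\to\mathbb R^{m+1}$ with $du=U_h$; it is unique up to adding a constant vector, and every such $u$ is a solution for $(g,\nu)$ with second fundamental form $h$. 3. Conversely, if $u$ is a solution for $(g,\nu)$, then its second fundamental form $h$ is compatible, and $du=U_h$. -/

import Mathlib

open scoped ContDiff

noncomputable section

namespace GaussMap

/-- Euclidean space `ℝⁿ`. -/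
abbrev Euc (n : ℕ) : Type := EuclideanSpace ℝ (Fin n)

/-- A smooth Riemannian metric on the open set `Ω ⊆ ℝᵐ`. -/
structure IsMetricOn {m : ℕ} (g : Euc m → Euc m →L[ℝ] Euc m →L[ℝ] ℝ) (Ω : Set (Euc m)) :
    Prop where
  smooth : ContDiffOn ℝ ∞ g Ω
  symm : ∀ x ∈ Ω, ∀ v w, g x v w = g x w v
  pos : ∀ x ∈ Ω, ∀ v, v ≠ 0 → 0 < g x v v

/-- Raising an index with `g` at `x`: the vector `sharp g x φ` satisfies
`g (sharp g x φ) v = φ v` for all `v`. -/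
def sharp {m : ℕ} (g : Euc m → Euc m →L[ℝ] Euc m →L[ℝ] ℝ) (x : Euc m) :
    (Euc m →L[ℝ] ℝ) →L[ℝ] Euc m :=
  (g x).inverse

/-- The endomorphism `b^♯` associated to a bilinear form `b` at `x`:
`g (b^♯ v) w = b v w`. -/
def raise {m : ℕ} (g : Euc m → Euc m →L[ℝ] Euc m →L[ℝ] ℝ) (x : Euc m)
    (b : Euc m →L[ℝ] Euc m →L[ℝ] ℝ) : Euc m →L[ℝ] Euc m :=
  (sharp g x).comp b

/-- The Christoffel term `Γ(v, w) = vⁱ wʲ Γᵏᵢⱼ eₖ` of `g` at `x`, given by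
`g (Γ(v, w)) z = ½ (∂ᵥ g(w, z) + ∂_w g(v, z) - ∂_z g(v, w))`. -/
def christoffel {m : ℕ} (g : Euc m → Euc m →L[ℝ] Euc m →L[ℝ] ℝ) (x v w : Euc m) : Euc m :=
  sharp g x ((1 / 2 : ℝ) • (fderiv ℝ g x v w + fderiv ℝ g x w v
    - ((fderiv ℝ g x).flip v).flip w))

/-- The Levi-Civita covariant derivative `∇ᵥ W` at `x`, for a vector field `W`. -/
def leviCivita {m : ℕ} (g : Euc m → Euc m →L[ℝ] Euc m →L[ℝ] ℝ) (W : Euc m → Euc m)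
    (x v : Euc m) : Euc m :=
  fderiv ℝ W x v + christoffel g x v (W x)

/-- The fibre `ν(x)^⊥ ⊆ ℝᵐ⁺¹` of the bundle `ν^⊥`. -/
abbrev perp {m : ℕ} (ν : Euc m → Euc (m + 1)) (x : Euc m) : Submodule ℝ (Euc (m + 1)) :=
  (Submodule.span ℝ {ν x})ᗮ

/-- The projection connection on `ν^⊥`: the derivative of a section `s`, projected to `ν^⊥`. -/
def projConnection {m : ℕ} (ν : Euc m → Euc (m + 1)) (s : (x : Euc m) → perp ν x)
    (x v : Euc m) : perp ν x :=
  (perp ν x).orthogonalProjectionOnto (fderiv ℝ (fun y => (s y : Euc (m + 1))) x v)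

/-- `A = dν` as a map into `ν^⊥`. For a map into the unit sphere, `dν` has values in `ν^⊥`
already, so that the projection only adjusts the codomain: see `coe_dNu`. -/
def dNu {m : ℕ} (ν : Euc m → Euc (m + 1)) (x : Euc m) : Euc m →L[ℝ] perp ν x :=
  (perp ν x).orthogonalProjectionOnto.comp (fderiv ℝ ν x)

theorem coe_dNu {m : ℕ} {Ω : Set (Euc m)} (hΩ : IsOpen Ω) {ν : Euc m → Euc (m + 1)}
    (hν : DifferentiableOn ℝ ν Ω) (hunit : ∀ x ∈ Ω, ‖ν x‖ = 1) {x : Euc m} (hx : x ∈ Ω)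
    (v : Euc m) : (dNu ν x v : Euc (m + 1)) = fderiv ℝ ν x v := by
  have hd : HasFDerivAt ν (fderiv ℝ ν x) x :=
    ((hν x hx).differentiableAt (hΩ.mem_nhds hx)).hasFDerivAt
  have h1 := hd.inner ℝ hd
  have h2 : HasFDerivAt (fun y => inner ℝ (ν y) (ν y)) (0 : Euc m →L[ℝ] ℝ) x := by
    refine (hasFDerivAt_const (1 : ℝ) x).congr_of_eventuallyEq ?_
    filter_upwards [hΩ.mem_nhds hx] with y hy
    simp [hunit y hy]
  have h3 := congrArg (fun L => L v) (h1.unique h2)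
  have h4 : inner ℝ (ν x) (fderiv ℝ ν x v) = 0 := by
    simp [real_inner_comm] at h3
    linarith
  have h5 : fderiv ℝ ν x v ∈ perp ν x := Submodule.mem_orthogonal_singleton_iff_inner_right.2 h4
  exact congrArg Subtype.val (Submodule.orthogonalProjectionOnto_mem_subspace_eq_self
    (⟨_, h5⟩ : perp ν x))

/-- The adjoint `A^* : ν^⊥ → TM` of `A = dν`, with respect to `g` on `TM` and the Euclidean
inner product on `ν^⊥`: `g (A^* ξ) v = ⟨ξ, A v⟩`. -/
def dNuAdjoint {m : ℕ} (g : Euc m → Euc m →L[ℝ] Euc m →L[ℝ] ℝ) (ν : Euc m → Euc (m + 1))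
    (x : Euc m) : perp ν x →L[ℝ] Euc m :=
  (sharp g x).comp ((innerSL ℝ).flip.comp (dNu ν x)).flip

/-- The third fundamental form `k(v, w) = ⟨A v, A w⟩`. -/
def thirdForm {m : ℕ} (ν : Euc m → Euc (m + 1)) (x : Euc m) : Euc m →L[ℝ] Euc m →L[ℝ] ℝ :=
  (innerSL ℝ).bilinearComp (dNu ν x) (dNu ν x)

/-- The bundle homomorphism `U = -(A^*)⁻¹ h : TM → ν^⊥`. -/
def bundleHom {m : ℕ} (g : Euc m → Euc m →L[ℝ] Euc m →L[ℝ] ℝ) (ν : Euc m → Euc (m + 1))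
    (h : Euc m → Euc m →L[ℝ] Euc m →L[ℝ] ℝ) (x : Euc m) : Euc m →L[ℝ] perp ν x :=
  -((dNuAdjoint g ν x).inverse.comp (raise g x (h x)))

/-- `U : TM → ν^⊥` is isometric over `Ω`. -/
def IsIsometricHom {m : ℕ} (g : Euc m → Euc m →L[ℝ] Euc m →L[ℝ] ℝ) (ν : Euc m → Euc (m + 1))
    (Ω : Set (Euc m)) (U : (x : Euc m) → Euc m →L[ℝ] perp ν x) : Prop :=
  ∀ x ∈ Ω, ∀ v w, inner ℝ (U x v) (U x w) = g x v w

/-- `U : TM → ν^⊥` is parallel over `Ω` with respect to the Levi-Civita connection on `TM` and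
the projection connection on `ν^⊥`. -/
def IsParallelHom {m : ℕ} (g : Euc m → Euc m →L[ℝ] Euc m →L[ℝ] ℝ) (ν : Euc m → Euc (m + 1))
    (Ω : Set (Euc m)) (U : (x : Euc m) → Euc m →L[ℝ] perp ν x) : Prop :=
  ∀ W : Euc m → Euc m, ContDiffOn ℝ ∞ W Ω → ∀ x ∈ Ω, ∀ v,
    projConnection ν (fun y => U y (W y)) x v = U x (leviCivita g W x v)

/-- `h` is a smooth symmetric bilinear form on `Ω` with `h² = k` (as endomorphisms), such that
`U = -(A^*)⁻¹ h` is isometric and parallel. -/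
structure IsCompatibleForm {m : ℕ} (g : Euc m → Euc m →L[ℝ] Euc m →L[ℝ] ℝ)
    (ν : Euc m → Euc (m + 1)) (Ω : Set (Euc m)) (h : Euc m → Euc m →L[ℝ] Euc m →L[ℝ] ℝ) :
    Prop where
  smooth : ContDiffOn ℝ ∞ h Ω
  symm : ∀ x ∈ Ω, ∀ v w, h x v w = h x w v
  sq_eq : ∀ x ∈ Ω, (raise g x (h x)).comp (raise g x (h x)) = raise g x (thirdForm ν x)
  isometric : IsIsometricHom g ν Ω (bundleHom g ν h)
  parallel : IsParallelHom g ν Ω (bundleHom g ν h)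

/-- `u` is a smooth immersion of `Ω` with first fundamental form `g` and Gauss map `ν`
(where `ν` is of unit length). It is an immersion since `g` is positive definite. -/
structure IsSolution {m : ℕ} (g : Euc m → Euc m →L[ℝ] Euc m →L[ℝ] ℝ)
    (ν : Euc m → Euc (m + 1)) (Ω : Set (Euc m)) (u : Euc m → Euc (m + 1)) : Prop where
  smooth : ContDiffOn ℝ ∞ u Ω
  isometric : ∀ x ∈ Ω, ∀ v w, inner ℝ (fderiv ℝ u x v) (fderiv ℝ u x w) = g x v w
  normal : ∀ x ∈ Ω, ∀ v, inner ℝ (fderiv ℝ u x v) (ν x) = 0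

/-- The data `(g, ν)` are admissible on `Ω`. -/
def Admissible {m : ℕ} (g : Euc m → Euc m →L[ℝ] Euc m →L[ℝ] ℝ) (ν : Euc m → Euc (m + 1))
    (Ω : Set (Euc m)) : Prop :=
  ∃ u, IsSolution g ν Ω u

/-- The second fundamental form `h(v, w) = ⟨D²u(v, w), ν⟩`. -/
def secondForm {m : ℕ} (u ν : Euc m → Euc (m + 1)) (x : Euc m) :
    Euc m →L[ℝ] Euc m →L[ℝ] ℝ :=
  (ContinuousLinearMap.compL ℝ (Euc m) (Euc (m + 1)) ℝ (innerSL ℝ (ν x))).comp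
    (fderiv ℝ (fderiv ℝ u) x)

/-- `du = U` on `Ω`. -/
def HasDifferential {m : ℕ} (ν : Euc m → Euc (m + 1)) (Ω : Set (Euc m))
    (u : Euc m → Euc (m + 1)) (U : (x : Euc m) → Euc m →L[ℝ] perp ν x) : Prop :=
  ∀ x ∈ Ω, HasFDerivAt u ((perp ν x).subtypeL.comp (U x)) x

end GaussMap

end

/-! Everything rests on one identity. If `⟨η w, ν⟩ = 0` for an `ℝᵐ⁺¹`-valued 1-form `η`,
differentiation gives `⟨ν, Dη(v, w)⟩ = -⟨η w, A v⟩` (`inner_fderiv_apply_of_normal`).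

For a solution `u`, taking `η = du` gives `A^* du = -h`, that is `du = U_h`. Isometry of `U_h` is
then the first fundamental form condition. Parallelism says that the tangential part of `D²u` is the
Christoffel term, which follows from differentiating `g = ⟨du, du⟩`
(`inner_fderiv_fderiv_tangential`). Isometry and the symmetry of `h` give `U h^♯ = -A`, whence `h² =
k`.

For a compatible `h`, taking `η = U_h` shows that the normal part of `DU_h(v, w)` is `h(v, w)`; by
parallelism its tangential part is `U_h Γ(v, w)`. Both are symmetric, so `U_h` is a closed form
(`fderiv_bundleForm_symm`). On a simply connected set it has a primitive
(`exists_hasFDerivAt_of_isSimplyConnected`), which is the required immersion. -/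

noncomputable section

namespace GaussMap
open Topology Set

/-! ### Closed 1-forms on simply connected open sets -/

/-- Functions given locally on a simply connected space that differ by locally constant functions
glue to a global function, up to locally constant functions. -/
theorem exists_glue_of_locally_constant_sub {X F : Type*} [TopologicalSpace X]
    [SimplyConnectedSpace X] [LocallyPathConnectedSpace X] [AddCommGroup F]
    (s : X → Set X) (hs : ∀ i, IsOpen (s i)) (hmem : ∀ x, x ∈ s x) (f : X → X → F)
    (hf : ∀ i j, ∀ x ∈ s i ∩ s j, ∀ᶠ y in 𝓝 x, f i y - f j y = f i x - f j x) :
    ∃ u : X → F, ∀ x, ∀ᶠ y in 𝓝 x, u y - f x y = u x - f x x := by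
  -- With discrete fibres the bundle below is a covering, and continuous means locally constant.
  let tF : TopologicalSpace F := ⊥
  have : DiscreteTopology F := ⟨rfl⟩
  let Z : FiberBundleCore X X F :=
    { baseSet := s
      isOpen_baseSet := hs
      indexAt := id
      mem_baseSet_at := hmem
      -- This choice makes `v + f i x` independent of the chart: a point of the fibre is a candidate
      -- value of `u` at `x`, recorded relative to `f i`.
      coordChange := fun i j x v => v + (f i x - f j x)
      coordChange_self := by simp
      continuousOn_coordChange := by
        intro i j p hp
        refine ContinuousAt.continuousWithinAt ?_
        have h1 : ContinuousAt (fun x => f i x - f j x) p.1 :=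
          (continuousAt_const (y := f i p.1 - f j p.1)).congr
            ((hf i j p.1 hp.1).mono fun y hy => hy.symm)
        have h2 : ContinuousAt (fun p : X × F => f i p.1 - f j p.1) p :=
          h1.comp (f := Prod.fst) continuousAt_fst
        exact (continuous_of_discreteTopology (f := fun q : F × F => q.1 + q.2)).continuousAt.comp
          (continuousAt_snd.prodMk h2)
      coordChange_comp := by
        intro i j k x _ v
        abel }
  have hcov : IsCoveringMap (Bundle.TotalSpace.proj : Bundle.TotalSpace F Z.Fiber → X) :=
    FiberBundle.isCoveringMap
  obtain ⟨a⟩ : Nonempty X := inferInstance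
  -- Lifting the identity map of the simply connected base yields a global section.
  obtain ⟨σ, ⟨-, hσ⟩, -⟩ := hcov.existsUnique_continuousMap_lifts (ContinuousMap.id X) a
    (⟨a, (0 : F)⟩ : Bundle.TotalSpace F Z.Fiber) rfl
  have hproj : ∀ x, (σ x).proj = x := fun x => congrFun hσ x
  have key : ∀ x, ∀ᶠ y in 𝓝 x, (Z.localTriv x (σ y)).2 = (Z.localTriv x (σ x)).2 := by
    intro x
    have hc : ContinuousAt (fun y => (Z.localTriv x (σ y)).2) x := by
      refine continuousAt_snd.comp (ContinuousAt.comp (g := Z.localTriv x) ?_ σ.continuous.continuousAt)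
      refine (Z.localTriv x).continuousAt ?_
      rw [Bundle.Trivialization.mem_source]
      change (σ x).proj ∈ s x
      rw [hproj]
      exact hmem x
    exact hc.eventually (discreteTopology_iff_singleton_mem_nhds.1 this _)
  let fib : Bundle.TotalSpace F Z.Fiber → F := fun p => p.snd
  -- In the chart at `x` the section reads `u - f x`, which is locally constant by `key`.
  refine ⟨fun x => fib (σ x) + f (σ x).proj (σ x).proj, fun x => ?_⟩
  filter_upwards [key x] with y hy
  have h3 : ∀ z, (Z.localTriv x (σ z)).2 = fib (σ z) + (f (σ z).proj (σ z).proj - f x (σ z).proj) :=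
    fun z => rfl
  rw [h3, h3] at hy
  rw [hproj] at hy ⊢
  simp only [hproj] at hy ⊢
  rw [add_sub_assoc, add_sub_assoc]
  exact hy

/-- A closed `1`-form on a simply connected open set is exact. -/
theorem exists_hasFDerivAt_of_isSimplyConnected {E F : Type*} [NormedAddCommGroup E]
    [NormedSpace ℝ E] [NormedAddCommGroup F] [NormedSpace ℝ F] [CompleteSpace F]
    {Ω : Set E} (hΩ : IsOpen Ω) (hsc : IsSimplyConnected Ω) {η : E → E →L[ℝ] F}
    (hη : DifferentiableOn ℝ η Ω)
    (hclosed : ∀ x ∈ Ω, ∀ v w, fderiv ℝ η x v w = fderiv ℝ η x w v) :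
    ∃ u : E → F, ∀ x ∈ Ω, HasFDerivAt u (η x) x := by
  have := hsc.simplyConnectedSpace
  have : LocallyPathConnectedSpace Ω := hΩ.locallyPathConnectedSpace
  choose! r hr hball using Metric.isOpen_iff.1 hΩ
  have hprim : ∀ x : Ω, ∃ f : E → F, ∀ a ∈ Metric.ball (x : E) (r x), HasFDerivAt f (η a) a :=
    fun x => (convex_ball (x : E) (r x)).exists_forall_hasFDerivAt_of_fderiv_symmetric
      Metric.isOpen_ball (hη.mono (hball x x.2)) fun a ha => hclosed a (hball x x.2 ha)
  choose f hf using hprim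
  obtain ⟨u, hu⟩ := exists_glue_of_locally_constant_sub
    (fun x : Ω => Subtype.val ⁻¹' Metric.ball (x : E) (r x))
    (fun x => Metric.isOpen_ball.preimage continuous_subtype_val)
    (fun x => Metric.mem_ball_self (hr x x.2)) (fun x y => f x y) (by
      intro i j x hx
      have hx' : (x : E) ∈ Metric.ball (i : E) (r i) ∩ Metric.ball (j : E) (r j) := hx
      have hopen : IsOpen (Metric.ball (i : E) (r i) ∩ Metric.ball (j : E) (r j)) :=
        Metric.isOpen_ball.inter Metric.isOpen_ball
      filter_upwards [continuous_subtype_val.continuousAt (hopen.mem_nhds hx')] with y hy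
      have hd : ∀ a ∈ Metric.ball (i : E) (r i) ∩ Metric.ball (j : E) (r j),
          HasFDerivAt (fun z => f i z - f j z) (0 : E →L[ℝ] F) a := fun a ha => by
        have := (hf i a ha.1).fun_sub (hf j a ha.2)
        rwa [sub_self] at this
      -- The intersection of two balls is convex, hence connected, so two primitives differ there by
      -- a constant.
      exact hopen.is_const_of_fderiv_eq_zero
        ((convex_ball _ _).inter (convex_ball _ _)).isPreconnected
        (fun a ha => (hd a ha).differentiableAt.differentiableWithinAt)
        (fun a ha => (hd a ha).fderiv) hy hx')
  classical
  refine ⟨fun x => if hx : x ∈ Ω then u ⟨x, hx⟩ else 0, fun x hx => ?_⟩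
  have h1 := hf ⟨x, hx⟩ x (Metric.mem_ball_self (hr x hx))
  refine (h1.const_add (u ⟨x, hx⟩ - f ⟨x, hx⟩ x)).congr_of_eventuallyEq ?_
  have h2 := hu ⟨x, hx⟩
  rw [nhds_subtype_eq_comap, Filter.eventually_comap] at h2
  filter_upwards [h2, hΩ.mem_nhds hx] with y hy hyΩ
  simp only [hyΩ, dif_pos]
  rw [← hy ⟨y, hyΩ⟩ rfl]
  simp

end GaussMap
end

/-! ### Linear algebra of `g`, `A` and `A^*` at a point -/

noncomputable section

namespace GaussMap
open Topology Set

theorem isInvertible_of_injective_of_finrank_eq {E F : Type*} [NormedAddCommGroup E]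
    [NormedSpace ℝ E] [FiniteDimensional ℝ E] [NormedAddCommGroup F] [NormedSpace ℝ F]
    [FiniteDimensional ℝ F] (L : E →L[ℝ] F) (hL : ∀ v, L v = 0 → v = 0)
    (hd : Module.finrank ℝ E = Module.finrank ℝ F) : L.IsInvertible := by
  have hinj : Function.Injective L.toLinearMap := (injective_iff_map_eq_zero _).2 hL
  refine ⟨(LinearEquiv.ofInjectiveOfFinrankEq L.toLinearMap hinj hd).toContinuousLinearEquiv, ?_⟩
  ext v
  rfl

theorem finrank_continuousDual {E : Type*} [NormedAddCommGroup E] [NormedSpace ℝ E]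
    [FiniteDimensional ℝ E] : Module.finrank ℝ (E →L[ℝ] ℝ) = Module.finrank ℝ E := by
  rw [← (LinearMap.toContinuousLinearMap (𝕜 := ℝ) (E := E) (F' := ℝ)).finrank_eq]
  exact Subspace.dual_finrank_eq

section Pointwise

variable {m : ℕ} {g : Euc m → Euc m →L[ℝ] Euc m →L[ℝ] ℝ} {ν : Euc m → Euc (m + 1)}
  {Ω : Set (Euc m)} {x : Euc m}

theorem IsMetricOn.isInvertible (hg : IsMetricOn g Ω) (hx : x ∈ Ω) : (g x).IsInvertible := by
  refine isInvertible_of_injective_of_finrank_eq _ (fun v hv => ?_) finrank_continuousDual.symm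
  by_contra hne
  have := hg.pos x hx v hne
  simp [hv] at this

theorem IsMetricOn.apply_sharp (hg : IsMetricOn g Ω) (hx : x ∈ Ω) (φ : Euc m →L[ℝ] ℝ)
    (v : Euc m) : g x (sharp g x φ) v = φ v := by
  rw [sharp, (hg.isInvertible hx).self_apply_inverse]

theorem IsMetricOn.ext (hg : IsMetricOn g Ω) (hx : x ∈ Ω) {v w : Euc m}
    (h : ∀ z, g x v z = g x w z) : v = w :=
  (hg.isInvertible hx).injective (ContinuousLinearMap.ext h)

theorem IsMetricOn.apply_raise (hg : IsMetricOn g Ω) (hx : x ∈ Ω)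
    (b : Euc m →L[ℝ] Euc m →L[ℝ] ℝ) (v w : Euc m) : g x (raise g x b v) w = b v w :=
  hg.apply_sharp hx _ _

theorem IsMetricOn.apply_dNuAdjoint (hg : IsMetricOn g Ω) (hx : x ∈ Ω) (ξ : perp ν x)
    (v : Euc m) : g x (dNuAdjoint g ν x ξ) v = inner ℝ ξ (dNu ν x v) := by
  rw [dNuAdjoint, ContinuousLinearMap.comp_apply, hg.apply_sharp hx]
  rfl

theorem finrank_perp (hA : (dNu ν x).IsInvertible) : Module.finrank ℝ (perp ν x) = m := by
  obtain ⟨e, -⟩ := hA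
  simpa using e.toLinearEquiv.finrank_eq.symm

theorem eq_zero_of_inner_dNu_eq_zero (hA : (dNu ν x).IsInvertible) {ξ : perp ν x}
    (h : ∀ w, inner ℝ ξ (dNu ν x w) = 0) : ξ = 0 := by
  obtain ⟨w, rfl⟩ := hA.surjective ξ
  exact inner_self_eq_zero.1 (h w)

/-- The kernel of `A^*` is orthogonal to the range of `A`, which is all of `ν^⊥`; the dimensions
agree. -/
theorem IsMetricOn.isInvertible_dNuAdjoint (hg : IsMetricOn g Ω) (hx : x ∈ Ω)
    (hA : (dNu ν x).IsInvertible) : (dNuAdjoint g ν x).IsInvertible := by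
  refine isInvertible_of_injective_of_finrank_eq _ (fun ξ hξ => ?_)
    (by simpa using finrank_perp hA)
  refine eq_zero_of_inner_dNu_eq_zero hA fun w => ?_
  rw [← hg.apply_dNuAdjoint hx, hξ]
  simp

/-- `U = -(A^*)⁻¹ h` is determined by `⟨U v, A w⟩ = -h(v, w)`. -/
theorem IsMetricOn.bundleHom_eq_iff (hg : IsMetricOn g Ω) (hx : x ∈ Ω)
    (hA : (dNu ν x).IsInvertible) (h : Euc m → Euc m →L[ℝ] Euc m →L[ℝ] ℝ) (v : Euc m)
    (ξ : perp ν x) :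
    bundleHom g ν h x v = ξ ↔ ∀ w, inner ℝ ξ (dNu ν x w) = -h x v w := by
  have hB := hg.isInvertible_dNuAdjoint hx hA
  have h1 : bundleHom g ν h x v = ξ ↔ dNuAdjoint g ν x ξ = -raise g x (h x) v := by
    rw [bundleHom, neg_apply, ContinuousLinearMap.comp_apply]
    constructor
    · rintro rfl
      rw [map_neg, hB.self_apply_inverse]
    · intro h2
      rw [← neg_eq_iff_eq_neg] at h2
      rw [← h2, map_neg, hB.inverse_apply_self, neg_neg]
  rw [h1]
  constructor
  · intro h2 w
    rw [← hg.apply_dNuAdjoint hx, h2, map_neg, neg_apply, hg.apply_raise hx]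
  · intro h2
    refine hg.ext hx fun w => ?_
    rw [hg.apply_dNuAdjoint hx, h2, map_neg, neg_apply, hg.apply_raise hx]

theorem mem_perp_iff {ξ : Euc (m + 1)} : ξ ∈ perp ν x ↔ inner ℝ (ν x) ξ = 0 :=
  Submodule.mem_orthogonal_singleton_iff_inner_right

/-- A vector is determined by its projection to `ν^⊥` and its normal component. -/
theorem eq_of_proj_eq_of_inner_eq {ξ η : Euc (m + 1)}
    (h1 : (perp ν x).orthogonalProjectionOnto ξ = (perp ν x).orthogonalProjectionOnto η)
    (h2 : inner ℝ (ν x) ξ = inner ℝ (ν x) η) : ξ = η := by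
  have h3 : ξ - η ∈ perp ν x := by rw [mem_perp_iff, inner_sub_right, h2, sub_self]
  have h4 := Submodule.orthogonalProjectionOnto_mem_subspace_eq_self (⟨_, h3⟩ : perp ν x)
  simp only [map_sub, h1, sub_self] at h4
  exact sub_eq_zero.1 (congrArg Subtype.val h4).symm

end Pointwise

/-! ### Differentiating normality and the metric -/

section Calculus

variable {m : ℕ} {g : Euc m → Euc m →L[ℝ] Euc m →L[ℝ] ℝ} {ν : Euc m → Euc (m + 1)}
  {Ω : Set (Euc m)} {x : Euc m}

theorem hasFDerivAt_of_contDiffOn {E F : Type*} [NormedAddCommGroup E]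
    [NormedSpace ℝ E] [NormedAddCommGroup F] [NormedSpace ℝ F] {f : E → F} {s : Set E}
    (hf : ContDiffOn ℝ ∞ f s) (hs : IsOpen s) {x : E} (hx : x ∈ s) :
    HasFDerivAt f (fderiv ℝ f x) x :=
  ((hf.contDiffAt (hs.mem_nhds hx)).differentiableAt (by simp)).hasFDerivAt

/-- The derivative of an identity `⟨η w, ν⟩ = 0`. -/
theorem inner_fderiv_apply_of_normal (hΩ : IsOpen Ω) (hν : ContDiffOn ℝ ∞ ν Ω)
    {η : Euc m → Euc m →L[ℝ] Euc (m + 1)} (hη : ContDiffOn ℝ ∞ η Ω)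
    (hn : ∀ x ∈ Ω, ∀ v, inner ℝ (η x v) (ν x) = 0) (hx : x ∈ Ω) (v w : Euc m) :
    inner ℝ (ν x) (fderiv ℝ η x v w) = -inner ℝ (η x w) (fderiv ℝ ν x v) := by
  have h1 := ((hasFDerivAt_of_contDiffOn hη hΩ hx).clm_apply (hasFDerivAt_const w x)).inner ℝ
    (hasFDerivAt_of_contDiffOn hν hΩ hx)
  have h2 : HasFDerivAt (fun y => inner ℝ (η y w) (ν y)) (0 : Euc m →L[ℝ] ℝ) x := by
    refine (hasFDerivAt_const (0 : ℝ) x).congr_of_eventuallyEq ?_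
    filter_upwards [hΩ.mem_nhds hx] with y hy using hn y hy w
  have h3 := congrArg (fun L => L v) (h1.unique h2)
  simp at h3
  rw [real_inner_comm]
  linarith

theorem IsMetricOn.fderiv_symm (hg : IsMetricOn g Ω) (hΩ : IsOpen Ω) (hx : x ∈ Ω)
    (z v w : Euc m) : fderiv ℝ g x z v w = fderiv ℝ g x z w v := by
  have hd := hasFDerivAt_of_contDiffOn hg.smooth hΩ hx
  have h1 := (hd.clm_apply (hasFDerivAt_const v x)).clm_apply (hasFDerivAt_const w x)
  have h2 := (hd.clm_apply (hasFDerivAt_const w x)).clm_apply (hasFDerivAt_const v x)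
  have h3 := congrArg (fun L => L z) (h1.unique (h2.congr_of_eventuallyEq (by
    filter_upwards [hΩ.mem_nhds hx] with y hy using hg.symm y hy v w)))
  simpa using h3

theorem IsMetricOn.apply_christoffel (hg : IsMetricOn g Ω) (hx : x ∈ Ω) (v w z : Euc m) :
    g x (christoffel g x v w) z =
      1 / 2 * (fderiv ℝ g x v w z + fderiv ℝ g x w v z - fderiv ℝ g x z v w) := by
  rw [christoffel, hg.apply_sharp hx]
  simp

theorem IsMetricOn.christoffel_symm (hg : IsMetricOn g Ω) (hΩ : IsOpen Ω) (hx : x ∈ Ω)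
    (v w : Euc m) : christoffel g x v w = christoffel g x w v := by
  refine hg.ext hx fun z => ?_
  rw [hg.apply_christoffel hx, hg.apply_christoffel hx, hg.fderiv_symm hΩ hx z v w]
  ring

end Calculus
end GaussMap
end

/-! ### Smoothness and closedness of `U_h` -/

noncomputable section

namespace GaussMap
open Topology Set

variable {m : ℕ} {g : Euc m → Euc m →L[ℝ] Euc m →L[ℝ] ℝ} {ν : Euc m → Euc (m + 1)}
  {Ω : Set (Euc m)} {x : Euc m}

/-- The real inner product as an `ℝ`-bilinear map. -/
def innerBilin (n : ℕ) : Euc n →L[ℝ] Euc n →L[ℝ] ℝ :=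
  (isBoundedBilinearMap_inner (𝕜 := ℝ) (E := Euc n)).toContinuousLinearMap

theorem innerBilin_apply {n : ℕ} (ξ : Euc n) : innerBilin n ξ = innerSL ℝ ξ := rfl

/-- The map `ξ ↦ (⟨ξ, dν ·⟩, ⟨ν, ξ⟩)`. -/
def frameMap (ν : Euc m → Euc (m + 1)) (x : Euc m) :
    Euc (m + 1) →L[ℝ] (Euc m →L[ℝ] ℝ) × ℝ :=
  (ContinuousLinearMap.inl ℝ (Euc m →L[ℝ] ℝ) ℝ).comp
      (((ContinuousLinearMap.compL ℝ (Euc m) (Euc (m + 1)) ℝ).flip (fderiv ℝ ν x)).comp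
        (innerBilin (m + 1))) +
    (ContinuousLinearMap.inr ℝ (Euc m →L[ℝ] ℝ) ℝ).comp (innerBilin (m + 1) (ν x))

theorem frameMap_apply (ξ : Euc (m + 1)) :
    frameMap ν x ξ = ((innerSL ℝ ξ).comp (fderiv ℝ ν x), inner ℝ (ν x) ξ) := by
  simp [frameMap, innerBilin_apply]

theorem contDiffOn_frameMap (hΩ : IsOpen Ω) (hν : ContDiffOn ℝ ∞ ν Ω) :
    ContDiffOn ℝ ∞ (frameMap ν) Ω := by
  have h1 : ContDiffOn ℝ ∞ (fderiv ℝ ν) Ω := hν.fderiv_of_isOpen hΩ (by simp)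
  have h2 : ContDiffOn ℝ ∞
      (fun x => (ContinuousLinearMap.compL ℝ (Euc m) (Euc (m + 1)) ℝ).flip (fderiv ℝ ν x)) Ω :=
    ContDiff.comp_contDiffOn (ContinuousLinearMap.contDiff _) h1
  have h3 : ContDiffOn ℝ ∞ (fun x => innerBilin (m + 1) (ν x)) Ω :=
    (innerBilin (m + 1)).contDiff.comp_contDiffOn hν
  exact (contDiffOn_const.clm_comp (h2.clm_comp contDiffOn_const)).add
    (contDiffOn_const.clm_comp h3)

/-- A vector in the kernel lies in `ν^⊥` and is orthogonal to the range of `A`, so it vanishes; both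
sides have dimension `m + 1`. -/
theorem isInvertible_frameMap (hA : (dNu ν x).IsInvertible)
    (hcoe : ∀ v, (dNu ν x v : Euc (m + 1)) = fderiv ℝ ν x v) :
    (frameMap ν x).IsInvertible := by
  refine isInvertible_of_injective_of_finrank_eq _ (fun ξ hξ => ?_) ?_
  · rw [frameMap_apply, Prod.mk_eq_zero] at hξ
    have h0 := eq_zero_of_inner_dNu_eq_zero hA (ξ := ⟨ξ, mem_perp_iff.2 hξ.2⟩) fun w => by
      rw [Submodule.coe_inner, hcoe]
      exact congrArg (fun L => L w) hξ.1
    exact congrArg Subtype.val h0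
  · rw [Module.finrank_prod, finrank_continuousDual]
    simp

/-- `U = -(A^*)⁻¹ h` as a form with values in `ℝᵐ⁺¹`. -/
def bundleForm (g : Euc m → Euc m →L[ℝ] Euc m →L[ℝ] ℝ) (ν : Euc m → Euc (m + 1))
    (h : Euc m → Euc m →L[ℝ] Euc m →L[ℝ] ℝ) (x : Euc m) : Euc m →L[ℝ] Euc (m + 1) :=
  (perp ν x).subtypeL.comp (bundleHom g ν h x)

theorem coe_bundleHom (h : Euc m → Euc m →L[ℝ] Euc m →L[ℝ] ℝ) (v : Euc m) :
    (bundleHom g ν h x v : Euc (m + 1)) = bundleForm g ν h x v := rfl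

theorem inner_bundleForm_normal (h : Euc m → Euc m →L[ℝ] Euc m →L[ℝ] ℝ) (v : Euc m) :
    inner ℝ (bundleForm g ν h x v) (ν x) = 0 := by
  rw [real_inner_comm]
  exact mem_perp_iff.1 (bundleHom g ν h x v).2

theorem IsMetricOn.inner_bundleForm_fderiv (hg : IsMetricOn g Ω) (hx : x ∈ Ω)
    (hA : (dNu ν x).IsInvertible)
    (hcoe : ∀ v, (dNu ν x v : Euc (m + 1)) = fderiv ℝ ν x v)
    (h : Euc m → Euc m →L[ℝ] Euc m →L[ℝ] ℝ) (v w : Euc m) :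
    inner ℝ (bundleForm g ν h x v) (fderiv ℝ ν x w) = -h x v w := by
  rw [← (hg.bundleHom_eq_iff hx hA h v _).1 rfl w, ← hcoe]
  rfl

/-- The fibres `ν(x)^⊥` vary with `x`, so smoothness is read off from an equation between fixed
spaces: `U v` solves `frameMap ν x (U v) = (-h v, 0)`, and inversion of linear maps is smooth at
invertible ones. -/
theorem contDiffOn_bundleForm (hΩ : IsOpen Ω) (hg : IsMetricOn g Ω)
    (hν : ContDiffOn ℝ ∞ ν Ω) (hA : ∀ x ∈ Ω, (dNu ν x).IsInvertible)
    (hcoe : ∀ x ∈ Ω, ∀ v, (dNu ν x v : Euc (m + 1)) = fderiv ℝ ν x v)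
    {h : Euc m → Euc m →L[ℝ] Euc m →L[ℝ] ℝ} (hh : ContDiffOn ℝ ∞ h Ω) :
    ContDiffOn ℝ ∞ (bundleForm g ν h) Ω := by
  have h1 : ContDiffOn ℝ ∞ (fun x => (frameMap ν x).inverse.comp
      ((ContinuousLinearMap.inl ℝ (Euc m →L[ℝ] ℝ) ℝ).comp (-h x))) Ω := by
    refine ContDiffOn.clm_comp (fun x hx => ?_) (contDiffOn_const.clm_comp hh.neg)
    exact (isInvertible_frameMap (hA x hx) (hcoe x hx)).contDiffAt_map_inverse.comp_contDiffWithinAt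
      x (contDiffOn_frameMap hΩ hν x hx)
  refine h1.congr fun x hx => ?_
  have hB := isInvertible_frameMap (hA x hx) (hcoe x hx)
  ext1 v
  refine hB.injective ?_
  rw [ContinuousLinearMap.comp_apply, hB.self_apply_inverse, frameMap_apply]
  refine Prod.ext ?_ ?_
  · ext w
    exact hg.inner_bundleForm_fderiv hx (hA x hx) (hcoe x hx) h v w
  · exact mem_perp_iff.1 (bundleHom g ν h x v).2

/-- The derivative of `U` for a compatible form: the tangential part. -/
theorem proj_fderiv_bundleForm {h : Euc m → Euc m →L[ℝ] Euc m →L[ℝ] ℝ} (hΩ : IsOpen Ω)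
    (hU : ContDiffOn ℝ ∞ (bundleForm g ν h) Ω) (hpar : IsParallelHom g ν Ω (bundleHom g ν h))
    (hx : x ∈ Ω) (v w : Euc m) :
    (perp ν x).orthogonalProjectionOnto (fderiv ℝ (bundleForm g ν h) x v w) =
      bundleHom g ν h x (christoffel g x v w) := by
  -- For a constant field the covariant derivative reduces to the Christoffel term.
  have h1 := hpar (fun _ => w) contDiffOn_const x hx v
  have h2 := (hasFDerivAt_of_contDiffOn hU hΩ hx).clm_apply (hasFDerivAt_const w x)
  rw [projConnection, leviCivita, fderiv_fun_const] at h1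
  simp only [coe_bundleHom, h2.fderiv] at h1
  simpa using h1

theorem IsCompatibleForm.inner_fderiv_bundleForm {h : Euc m → Euc m →L[ℝ] Euc m →L[ℝ] ℝ}
    (hh : IsCompatibleForm g ν Ω h) (hΩ : IsOpen Ω) (hg : IsMetricOn g Ω)
    (hν : ContDiffOn ℝ ∞ ν Ω) (hA : ∀ x ∈ Ω, (dNu ν x).IsInvertible)
    (hcoe : ∀ x ∈ Ω, ∀ v, (dNu ν x v : Euc (m + 1)) = fderiv ℝ ν x v) (hx : x ∈ Ω)
    (v w : Euc m) : inner ℝ (ν x) (fderiv ℝ (bundleForm g ν h) x v w) = h x v w := by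
  rw [inner_fderiv_apply_of_normal hΩ hν (contDiffOn_bundleForm hΩ hg hν hA hcoe hh.smooth)
    (fun x _ v => inner_bundleForm_normal h v) hx, hg.inner_bundleForm_fderiv hx (hA x hx)
    (hcoe x hx), neg_neg, hh.symm x hx]

/-- Closedness of `U_h`: the tangential part is symmetric because the Levi-Civita connection is
torsion-free, the normal part because `h` is symmetric. -/
theorem IsCompatibleForm.fderiv_bundleForm_symm {h : Euc m → Euc m →L[ℝ] Euc m →L[ℝ] ℝ}
    (hh : IsCompatibleForm g ν Ω h) (hΩ : IsOpen Ω) (hg : IsMetricOn g Ω)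
    (hν : ContDiffOn ℝ ∞ ν Ω) (hA : ∀ x ∈ Ω, (dNu ν x).IsInvertible)
    (hcoe : ∀ x ∈ Ω, ∀ v, (dNu ν x v : Euc (m + 1)) = fderiv ℝ ν x v) (hx : x ∈ Ω)
    (v w : Euc m) :
    fderiv ℝ (bundleForm g ν h) x v w = fderiv ℝ (bundleForm g ν h) x w v := by
  have hU := contDiffOn_bundleForm hΩ hg hν hA hcoe hh.smooth
  refine eq_of_proj_eq_of_inner_eq (ν := ν) (x := x) ?_ ?_
  · rw [proj_fderiv_bundleForm hΩ hU hh.parallel hx, proj_fderiv_bundleForm hΩ hU hh.parallel hx,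
      hg.christoffel_symm hΩ hx]
  · rw [hh.inner_fderiv_bundleForm hΩ hg hν hA hcoe hx,
      hh.inner_fderiv_bundleForm hΩ hg hν hA hcoe hx, hh.symm x hx]

/-- A primitive of `U`, for a compatible form `h`, is a solution with second fundamental form
`h`. -/
theorem IsCompatibleForm.isSolution_of_hasDifferential
    {h : Euc m → Euc m →L[ℝ] Euc m →L[ℝ] ℝ}
    (hh : IsCompatibleForm g ν Ω h) (hΩ : IsOpen Ω) (hg : IsMetricOn g Ω)
    (hν : ContDiffOn ℝ ∞ ν Ω) (hA : ∀ x ∈ Ω, (dNu ν x).IsInvertible)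
    (hcoe : ∀ x ∈ Ω, ∀ v, (dNu ν x v : Euc (m + 1)) = fderiv ℝ ν x v)
    {u : Euc m → Euc (m + 1)} (hu : HasDifferential ν Ω u (bundleHom g ν h)) :
    IsSolution g ν Ω u ∧ ∀ x ∈ Ω, secondForm u ν x = h x := by
  have hU := contDiffOn_bundleForm hΩ hg hν hA hcoe hh.smooth
  have hdu : ∀ x ∈ Ω, fderiv ℝ u x = bundleForm g ν h x := fun x hx => (hu x hx).fderiv
  refine ⟨⟨?_, fun x hx v w => ?_, fun x hx v => ?_⟩, fun x hx => ?_⟩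
  · refine (contDiffOn_infty_iff_fderiv_of_isOpen hΩ).2
      ⟨fun x hx => (hu x hx).differentiableAt.differentiableWithinAt, hU.congr hdu⟩
  · rw [hdu x hx]
    exact hh.isometric x hx v w
  · rw [hdu x hx]
    exact inner_bundleForm_normal h v
  · have h1 : fderiv ℝ (fderiv ℝ u) x = fderiv ℝ (bundleForm g ν h) x :=
      Filter.EventuallyEq.fderiv_eq (by filter_upwards [hΩ.mem_nhds hx] using hdu)
    ext v w
    rw [← hh.inner_fderiv_bundleForm hΩ hg hν hA hcoe hx, ← h1]
    rfl

/-! ### The second fundamental form of a solution is compatible -/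

section Solution

variable {u : Euc m → Euc (m + 1)}

theorem secondForm_apply (v w : Euc m) :
    secondForm u ν x v w = inner ℝ (ν x) (fderiv ℝ (fderiv ℝ u) x v w) := rfl

theorem IsSolution.contDiffOn_fderiv (hu : IsSolution g ν Ω u) (hΩ : IsOpen Ω) :
    ContDiffOn ℝ ∞ (fderiv ℝ u) Ω :=
  hu.smooth.fderiv_of_isOpen hΩ (by simp)

theorem IsSolution.fderiv_fderiv_symm (hu : IsSolution g ν Ω u) (hΩ : IsOpen Ω) (hx : x ∈ Ω)
    (v w : Euc m) : fderiv ℝ (fderiv ℝ u) x v w = fderiv ℝ (fderiv ℝ u) x w v :=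
  ((hu.smooth.contDiffAt (hΩ.mem_nhds hx)).isSymmSndFDerivAt
    (by rw [minSmoothness_of_isRCLikeNormedField]
        exact WithTop.coe_le_coe.2 (le_top : (2 : ℕ∞) ≤ ⊤))) v w

theorem IsSolution.secondForm_symm (hu : IsSolution g ν Ω u) (hΩ : IsOpen Ω) (hx : x ∈ Ω)
    (v w : Euc m) : secondForm u ν x v w = secondForm u ν x w v := by
  rw [secondForm_apply, secondForm_apply, hu.fderiv_fderiv_symm hΩ hx]

theorem IsSolution.inner_fderiv_fderiv (hu : IsSolution g ν Ω u) (hΩ : IsOpen Ω)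
    (hν : ContDiffOn ℝ ∞ ν Ω) (hx : x ∈ Ω) (v w : Euc m) :
    inner ℝ (fderiv ℝ u x v) (fderiv ℝ ν x w) = -secondForm u ν x v w := by
  rw [hu.secondForm_symm hΩ hx, secondForm_apply,
    inner_fderiv_apply_of_normal hΩ hν (hu.contDiffOn_fderiv hΩ) hu.normal hx, neg_neg]

/-- The differential of a solution is `-(A^*)⁻¹ h`. -/
theorem IsSolution.bundleForm_secondForm (hu : IsSolution g ν Ω u) (hΩ : IsOpen Ω)
    (hg : IsMetricOn g Ω) (hν : ContDiffOn ℝ ∞ ν Ω) (hA : ∀ x ∈ Ω, (dNu ν x).IsInvertible)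
    (hcoe : ∀ x ∈ Ω, ∀ v, (dNu ν x v : Euc (m + 1)) = fderiv ℝ ν x v) (hx : x ∈ Ω) :
    bundleForm g ν (secondForm u ν) x = fderiv ℝ u x := by
  ext1 v
  have hmem : fderiv ℝ u x v ∈ perp ν x := by
    rw [mem_perp_iff, real_inner_comm, hu.normal x hx]
  refine congrArg Subtype.val ((hg.bundleHom_eq_iff hx (hA x hx) (secondForm u ν) v ⟨_, hmem⟩).2
    fun w => ?_)
  rw [Submodule.coe_inner, hcoe x hx]
  exact hu.inner_fderiv_fderiv hΩ hν hx v w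

theorem IsSolution.fderiv_metric (hu : IsSolution g ν Ω u) (hΩ : IsOpen Ω)
    (hg : IsMetricOn g Ω) (hx : x ∈ Ω) (v w z : Euc m) :
    fderiv ℝ g x v w z = inner ℝ (fderiv ℝ (fderiv ℝ u) x v w) (fderiv ℝ u x z) +
      inner ℝ (fderiv ℝ u x w) (fderiv ℝ (fderiv ℝ u) x v z) := by
  have hd := hasFDerivAt_of_contDiffOn (hu.contDiffOn_fderiv hΩ) hΩ hx
  have h1 := (hd.clm_apply (hasFDerivAt_const w x)).inner ℝ (hd.clm_apply (hasFDerivAt_const z x))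
  have h2 := ((hasFDerivAt_of_contDiffOn hg.smooth hΩ hx).clm_apply
    (hasFDerivAt_const w x)).clm_apply (hasFDerivAt_const z x)
  have h3 := congrArg (fun L => L v) (h2.unique (h1.congr_of_eventuallyEq (by
    filter_upwards [hΩ.mem_nhds hx] with y hy using (hu.isometric y hy w z).symm)))
  simp at h3
  rw [h3]
  ring

/-- The tangential part of the second derivative of a solution. -/
theorem IsSolution.inner_fderiv_fderiv_tangential (hu : IsSolution g ν Ω u) (hΩ : IsOpen Ω)
    (hg : IsMetricOn g Ω) (hx : x ∈ Ω) (v w z : Euc m) :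
    inner ℝ (fderiv ℝ (fderiv ℝ u) x v w) (fderiv ℝ u x z) = g x (christoffel g x v w) z := by
  -- The three derivatives of `g` give six products; by symmetry of `D²u` four cancel and the other
  -- two coincide.
  rw [hg.apply_christoffel hx, hu.fderiv_metric hΩ hg hx, hu.fderiv_metric hΩ hg hx,
    hu.fderiv_metric hΩ hg hx, hu.fderiv_fderiv_symm hΩ hx w v, hu.fderiv_fderiv_symm hΩ hx z v,
    hu.fderiv_fderiv_symm hΩ hx z w, real_inner_comm (fderiv ℝ (fderiv ℝ u) x v z),
    real_inner_comm (fderiv ℝ (fderiv ℝ u) x w z)]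
  ring

theorem contDiffOn_secondForm (hu : IsSolution g ν Ω u) (hΩ : IsOpen Ω)
    (hν : ContDiffOn ℝ ∞ ν Ω) : ContDiffOn ℝ ∞ (secondForm u ν) Ω := by
  have h1 : ContDiffOn ℝ ∞ (fderiv ℝ (fderiv ℝ u)) Ω :=
    (hu.contDiffOn_fderiv hΩ).fderiv_of_isOpen hΩ (by simp)
  have h2 : ContDiffOn ℝ ∞ (fun x => innerBilin (m + 1) (ν x)) Ω :=
    (innerBilin (m + 1)).contDiff.comp_contDiffOn hν
  have h3 : ContDiffOn ℝ ∞ (fun x => ContinuousLinearMap.compL ℝ (Euc m) (Euc (m + 1)) ℝ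
      (innerBilin (m + 1) (ν x))) Ω :=
    ContDiff.comp_contDiffOn (ContinuousLinearMap.contDiff _) h2
  exact h3.clm_comp h1

/-- An isometric map is injective, and the dimensions agree. Identities in `ν^⊥` can therefore be
tested against vectors `U z`. -/
theorem bundleHom_surjective_of_isIsometricHom
    {U : (x : Euc m) → Euc m →L[ℝ] perp ν x} (hU : IsIsometricHom g ν Ω U)
    (hg : IsMetricOn g Ω) (hx : x ∈ Ω) (hA : (dNu ν x).IsInvertible) :
    Function.Surjective (U x) := by
  refine (isInvertible_of_injective_of_finrank_eq (U x) (fun v hv => ?_)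
    (by simpa using (finrank_perp hA).symm)).surjective
  by_contra hne
  have h1 := hg.pos x hx v hne
  rw [← hU x hx, hv] at h1
  simp at h1

theorem IsSolution.isCompatibleForm_secondForm (hu : IsSolution g ν Ω u) (hΩ : IsOpen Ω)
    (hg : IsMetricOn g Ω) (hν : ContDiffOn ℝ ∞ ν Ω) (hA : ∀ x ∈ Ω, (dNu ν x).IsInvertible)
    (hcoe : ∀ x ∈ Ω, ∀ v, (dNu ν x v : Euc (m + 1)) = fderiv ℝ ν x v) :
    IsCompatibleForm g ν Ω (secondForm u ν) := by
  have hU := fun x (hx : x ∈ Ω) => hu.bundleForm_secondForm hΩ hg hν hA hcoe hx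
  have hiso : IsIsometricHom g ν Ω (bundleHom g ν (secondForm u ν)) := fun x hx v w => by
    rw [Submodule.coe_inner, coe_bundleHom, coe_bundleHom, hU x hx, hu.isometric x hx]
  have hsymm := fun x (hx : x ∈ Ω) => hu.secondForm_symm hΩ hx
  refine ⟨contDiffOn_secondForm hu hΩ hν, hsymm, fun x hx => ?_, hiso, fun W hW x hx v => ?_⟩
  · have hsurj := bundleHom_surjective_of_isIsometricHom hiso hg hx (hA x hx)
    set S := raise g x (secondForm u ν x)
    -- `U S = -A`, because `⟨U S v, U z⟩ = g(S v, z) = h(z, v) = -⟨U z, A v⟩`.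
    have hUS : ∀ v, bundleHom g ν (secondForm u ν) x (S v) = -dNu ν x v := fun v => by
      refine ext_inner_right ℝ fun η => ?_
      obtain ⟨z, rfl⟩ := hsurj η
      rw [hiso x hx, hg.apply_raise hx, hsymm x hx, inner_neg_left, real_inner_comm,
        (hg.bundleHom_eq_iff hx (hA x hx) _ z _).1 rfl v, neg_neg]
    -- As `S` is self-adjoint, `g(S² v, w) = g(S v, S w) = ⟨U S v, U S w⟩ = ⟨A v, A w⟩`.
    ext1 v
    refine hg.ext hx fun w => ?_
    rw [ContinuousLinearMap.comp_apply, hg.apply_raise hx, hg.apply_raise hx, hsymm x hx,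
      ← hg.apply_raise hx, hg.symm x hx, ← hiso x hx, hUS, hUS, inner_neg_neg]
    rfl
  · have hsurj := bundleHom_surjective_of_isIsometricHom hiso hg hx (hA x hx)
    have hd := (hasFDerivAt_of_contDiffOn (hu.contDiffOn_fderiv hΩ) hΩ hx).clm_apply
      (hasFDerivAt_of_contDiffOn hW hΩ hx)
    have h1 : fderiv ℝ (fun y => (bundleHom g ν (secondForm u ν) y (W y) : Euc (m + 1))) x v =
        fderiv ℝ u x (fderiv ℝ W x v) + fderiv ℝ (fderiv ℝ u) x v (W x) := by
      rw [(hd.congr_of_eventuallyEq (by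
        filter_upwards [hΩ.mem_nhds hx] with y hy
        rw [coe_bundleHom, hU y hy])).fderiv]
      simp
    -- Pairing with `U z`, which lies in `ν^⊥`, removes the projection; the two terms of `h1` then
    -- match the two terms of the covariant derivative.
    refine ext_inner_right ℝ fun η => ?_
    obtain ⟨z, rfl⟩ := hsurj η
    rw [projConnection, h1, hiso x hx, leviCivita, map_add, map_add, add_apply,
      ← hu.inner_fderiv_fderiv_tangential hΩ hg hx, ← hu.isometric x hx,
      ← map_add, Submodule.inner_orthogonalProjectionOnto_eq_of_mem_right, coe_bundleHom, hU x hx,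
      inner_add_left]

end Solution
end GaussMap
end

/-! ### Uniqueness of the primitive and the main theorem -/

namespace GaussMap

theorem HasDifferential.exists_eq_add {m : ℕ} {ν : Euc m → Euc (m + 1)} {Ω : Set (Euc m)}
    (hΩ : IsOpen Ω) (hc : IsPreconnected Ω) {U : (x : Euc m) → Euc m →L[ℝ] perp ν x}
    {u₁ u₂ : Euc m → Euc (m + 1)} (h₁ : HasDifferential ν Ω u₁ U)
    (h₂ : HasDifferential ν Ω u₂ U) : ∃ c, ∀ x ∈ Ω, u₂ x = u₁ x + c :=
  hΩ.exists_eq_add_of_fderiv_eq hc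
    (fun x hx => (h₂ x hx).differentiableAt.differentiableWithinAt)
    (fun x hx => (h₁ x hx).differentiableAt.differentiableWithinAt)
    fun x hx => (h₂ x hx).fderiv.trans (h₁ x hx).fderiv.symm

end GaussMap

theorem theorem1 (m : ℕ) (Ω : Set (GaussMap.Euc m)) (hΩ : IsOpen Ω)
    (hsc : IsSimplyConnected Ω)
    (g : GaussMap.Euc m → GaussMap.Euc m →L[ℝ] GaussMap.Euc m →L[ℝ] ℝ)
    (hg : GaussMap.IsMetricOn g Ω)
    (ν : GaussMap.Euc m → GaussMap.Euc (m + 1)) (hν : ContDiffOn ℝ ∞ ν Ω)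
    (hunit : ∀ x ∈ Ω, ν x ∈ Metric.sphere (0 : GaussMap.Euc (m + 1)) 1)
    (hA : ∀ x ∈ Ω, (GaussMap.dNu ν x).IsInvertible) :
    (GaussMap.Admissible g ν Ω ↔ ∃ h, GaussMap.IsCompatibleForm g ν Ω h) ∧
    (∀ h, GaussMap.IsCompatibleForm g ν Ω h →
      (∃ u, GaussMap.HasDifferential ν Ω u (GaussMap.bundleHom g ν h)) ∧
      (∀ u, GaussMap.HasDifferential ν Ω u (GaussMap.bundleHom g ν h) →
        GaussMap.IsSolution g ν Ω u ∧ ∀ x ∈ Ω, GaussMap.secondForm u ν x = h x) ∧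
      (∀ u₁ u₂, GaussMap.HasDifferential ν Ω u₁ (GaussMap.bundleHom g ν h) →
        GaussMap.HasDifferential ν Ω u₂ (GaussMap.bundleHom g ν h) →
        ∃ c, ∀ x ∈ Ω, u₂ x = u₁ x + c)) ∧
    (∀ u, GaussMap.IsSolution g ν Ω u →
      GaussMap.IsCompatibleForm g ν Ω (GaussMap.secondForm u ν) ∧
      GaussMap.HasDifferential ν Ω u (GaussMap.bundleHom g ν (GaussMap.secondForm u ν))) := by
  have hcoe : ∀ x ∈ Ω, ∀ v, (GaussMap.dNu ν x v : GaussMap.Euc (m + 1)) = fderiv ℝ ν x v :=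
    fun x hx v => GaussMap.coe_dNu hΩ (hν.differentiableOn (by simp))
      (fun y hy => by simpa using hunit y hy) hx v
  have hexists : ∀ h, GaussMap.IsCompatibleForm g ν Ω h →
      ∃ u, GaussMap.HasDifferential ν Ω u (GaussMap.bundleHom g ν h) := fun h hh =>
    GaussMap.exists_hasFDerivAt_of_isSimplyConnected hΩ hsc
      ((GaussMap.contDiffOn_bundleForm hΩ hg hν hA hcoe hh.smooth).differentiableOn (by simp))
      fun x hx => hh.fderiv_bundleForm_symm hΩ hg hν hA hcoe hx
  have hsol : ∀ h, GaussMap.IsCompatibleForm g ν Ω h → ∀ u,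
      GaussMap.HasDifferential ν Ω u (GaussMap.bundleHom g ν h) →
      GaussMap.IsSolution g ν Ω u ∧ ∀ x ∈ Ω, GaussMap.secondForm u ν x = h x :=
    fun h hh u hu => hh.isSolution_of_hasDifferential hΩ hg hν hA hcoe hu
  have hconv : ∀ u, GaussMap.IsSolution g ν Ω u →
      GaussMap.IsCompatibleForm g ν Ω (GaussMap.secondForm u ν) :=
    fun u hu => hu.isCompatibleForm_secondForm hΩ hg hν hA hcoe
  refine ⟨⟨fun ⟨u, hu⟩ => ⟨_, hconv u hu⟩, fun ⟨h, hh⟩ => ?_⟩, fun h hh => ⟨hexists h hh,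
    hsol h hh, fun u₁ u₂ h₁ h₂ => h₁.exists_eq_add hΩ hsc.isPathConnected.isConnected.isPreconnected
      h₂⟩, fun u hu => ⟨hconv u hu, fun x hx => ?_⟩⟩
  · obtain ⟨u, hu⟩ := hexists h hh
    exact ⟨u, (hsol h hh u hu).1⟩
  · have h1 := hu.bundleForm_secondForm hΩ hg hν hA hcoe hx
    have h2 := GaussMap.hasFDerivAt_of_contDiffOn hu.smooth hΩ hx
    rw [← h1] at h2
    exact h2
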